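/- All graphs are finite and loopless, and may have parallel edges. For a graph $G$ and a vertex set $S\subseteq V(G)$ let $d(S)$ be the number of edges with exactly one end in $S$, and let $d(v)$ be the degree of a vertex $v$. The multiplicity $\mu(G)$ is the maximum number of parallel edges joining two distinct vertices, $\delta(G)$ is the minimum degree and $e(G)$ is the number of edges. For an integer $\ell\ge 1$, a $\mathbb{Z}_{2\ell}$-boundary of $G$ is a map $\beta\colon V(G)\to\{0,1,\dots,2\ell-1\}$ with $\beta(v)\equiv d(v)\pmod 2$ for every vertex $v$ and $\sum_{v\in V(G)}\beta(v)\equiv 0\pmod{2\ell}$. A $\beta$-orientation is an orientation $D$ of $G$ with $d_D^+(v)-d_D^-(v)\equiv\beta(v)\pmod{2\ell}$ for every vertex $v$, where $d_D^+(v)$ and $d_D^-(v)$ are the numbers of arcs with tail $v$ and with head $v$. The graph $G$ is strongly $\mathbb{Z}_\ell$-connected if it has a $\beta$-orientation for every $\mathbb{Z}_{2\ell}$-boundary $\beta$ of $G$. Theorem. Let $\ell\ge 3$ be an integer and let $G$ be a graph with exactly $4$ vertices, $e(G)=3\ell-3$, $\mu(G)\le \ell-2$ and $\delta(G)\ge \ell-1$.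 Then $G$ is not strongly $\mathbb{Z}_\ell$-connected if and only if both of the following hold: (1) $d(S)=2\ell-2$ for every $S\subseteq V(G)$ with $|S|=2$; (2) $d(v)\equiv \ell\pmod 2$ for every $v\in V(G)$. Moreover, in this case the constant map $\beta=(\ell,\ell,\ell,\ell)$ is a $\mathbb{Z}_{2\ell}$-boundary of $G$, and it is the only $\mathbb{Z}_{2\ell}$-boundary $\beta$ of $G$ for which $G$ has no $\beta$-orientation. -/

import Mathlib

open scoped Graph

namespace Graph

variable {α β : Type*}

/-- The degree of a vertex: the number of incident edges, a loop being counted twice. -/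
noncomputable def deg (G : Graph α β) (v : α) : ℕ :=
  (G.incidenceSet v).ncard + (G.loopSet v).ncard

/-- The minimum degree `δ(G)` of a finite graph with at least one vertex. -/
noncomputable def minDeg (G : Graph α β) : ℕ :=
  sInf {d : ℕ | ∃ v ∈ V(G), d = G.deg v}

/-- The number of parallel edges joining `x` and `y`. -/
noncomputable def edgeMult (G : Graph α β) (x y : α) : ℕ :=
  {e : β | G.IsLink e x y}.ncard

/-- The multiplicity of a finite graph: the largest number of parallel edges that join
two distinct vertices. -/
noncomputable def maxMult (G : Graph α β) : ℕ :=
  sSup {m : ℕ | ∃ x ∈ V(G), ∃ y ∈ V(G), x ≠ y ∧ m = G.edgeMult x y}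

/-- The degree `d(S)` of a vertex set: the number of edges with one end in `S` and the other
end in the complement `V(G) \ S`. -/
noncomputable def cutDeg (G : Graph α β) (S : Set α) : ℕ :=
  {e : β | ∃ x ∈ S, ∃ y ∈ V(G) \ S, G.IsLink e x y}.ncard

/-- An orientation of `G`: every edge gets one of its ends as tail and the other as head. -/
structure EdgeOrientation (G : Graph α β) where
  tail : E(G) → α
  head : E(G) → α
  isLink : ∀ e : E(G), G.IsLink e (tail e) (head e)

/-- The number of arcs with tail `v`. -/
noncomputable def EdgeOrientation.outDeg {G : Graph α β} (D : G.EdgeOrientation) (v : α) : ℕ :=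
  {e : E(G) | D.tail e = v}.ncard

/-- The number of arcs with head `v`. -/
noncomputable def EdgeOrientation.inDeg {G : Graph α β} (D : G.EdgeOrientation) (v : α) : ℕ :=
  {e : E(G) | D.head e = v}.ncard

/-- `b : V(G) → {0, …, 2ℓ - 1}` is a (parity-compliant) `ℤ_{2ℓ}`-boundary of the finite
graph `G`. -/
def IsBoundary (G : Graph α β) (ℓ : ℕ) (b : V(G) → Fin (2 * ℓ)) : Prop :=
  (∀ v : V(G), (b v : ℕ) ≡ G.deg v [MOD 2]) ∧ (∑ᶠ v : V(G), (b v : ℕ)) ≡ 0 [MOD 2 * ℓ]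

/-- `D` is a `b`-orientation of `G`. -/
def EdgeOrientation.Realizes {G : Graph α β} {ℓ : ℕ} (D : G.EdgeOrientation)
    (b : V(G) → Fin (2 * ℓ)) : Prop :=
  ∀ v : V(G), (D.outDeg v : ℤ) - (D.inDeg v : ℤ) ≡ ((b v : ℕ) : ℤ) [ZMOD 2 * (ℓ : ℤ)]

/-- `G` is strongly `ℤ_ℓ`-connected. -/
def StronglyConnectedMod (G : Graph α β) (ℓ : ℕ) : Prop :=
  ∀ b : V(G) → Fin (2 * ℓ), G.IsBoundary ℓ b → ∃ D : G.EdgeOrientation, D.Realizes b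

end Graph

/-! Since `d⁺(v) + d⁻(v) = d(v)`, a `β`-orientation is an orientation whose out-degrees are
prescribed modulo `ℓ`, say by residues `p v < ℓ`; then `∑ p + k ℓ = e(G)` with `k ∈ {0, 1, 2}`. By
Hakimi's criterion a function `o` with total `e(G)` is an out-degree function as soon as every
vertex set `S` spans at most `∑_{v ∈ S} o v` edges, which on four vertices only has to be tested
on pairs and on complements of single vertices, that is, `μ(u, v) ≤ o u + o v` and `o v ≤ d(v)`.
It remains to distribute `k` increments by `ℓ` over the vertices so that no degree is exceeded and
every pair `u, v` with `p u + p v < μ(u, v)` contains one. This succeeds unless `k = 2` and all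
six pairs are of that kind. As the total deficiency of the six pairs is `e(G) - 3 ∑ p = 6`, then
`μ(u, v) = p u + p v + 1` throughout, which forces `d(v) = 2 p v + ℓ`, `d({u, v}) = 2ℓ - 2` and
`β = ℓ`.

Conversely, if `β = ℓ`, then `d⁺(v) - d⁻(v) = ± ℓ` at every vertex because `e(G) < 3ℓ`, and two
vertices with the same sign would need `2ℓ` edges in the cut around them. -/

namespace ModularOrientation

open Graph Finset

section Counting

variable {α β : Type*} {G : Graph α β}

/-- The number of edges with both ends in `S`, loops included. -/
noncomputable def edgesWithin (G : Graph α β) (S : Set α) : ℕ :=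
  {e : β | ∃ x ∈ S, ∃ y ∈ S, G.IsLink e x y}.ncard

/-- The orientation with every arc turned around. -/
def reverse (D : G.EdgeOrientation) : G.EdgeOrientation where
  tail := D.head
  head := D.tail
  isLink e := (D.isLink e).symm

/-- The number of arcs of `D` from `S` to the complement of `S`. -/
noncomputable def leaving (D : G.EdgeOrientation) (S : Set α) : ℕ :=
  {e : E(G) | D.tail e ∈ S ∧ D.head e ∉ S}.ncard

theorem nonempty_edgeOrientation (G : Graph α β) : Nonempty G.EdgeOrientation := by
  choose tail head isLink using fun e : E(G) ↦ G.exists_isLink_of_mem_edgeSet e.2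
  exact ⟨⟨tail, head, isLink⟩⟩

theorem ncard_edgeSet_subtype {P : β → Prop} (hP : ∀ e, P e → e ∈ E(G)) :
    {e : E(G) | P e}.ncard = {e | P e}.ncard := by
  rw [← Set.ncard_image_of_injective _ Subtype.val_injective]
  congr 1
  ext e
  simpa using fun he ↦ hP e he

theorem outDeg_add_inDeg [Finite E(G)] (D : G.EdgeOrientation) (v : α) :
    D.outDeg v + D.inDeg v = G.deg v := by
  have hinc : {e : E(G) | D.tail e = v} ∪ {e | D.head e = v} = {e : E(G) | G.Inc e v} := by
    ext e
    constructor
    · rintro (rfl | rfl)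
      exacts [(D.isLink e).inc_left, (D.isLink e).inc_right]
    · exact fun he ↦ (he.eq_or_eq_of_isLink (D.isLink e)).imp Eq.symm Eq.symm
  have hloop : {e : E(G) | D.tail e = v} ∩ {e | D.head e = v} = {e : E(G) | G.IsLoopAt e v} := by
    ext e
    simp [← isLink_self_iff, (D.isLink e).isLink_iff]
  calc D.outDeg v + D.inDeg v
      = {e : E(G) | G.Inc e v}.ncard + {e : E(G) | G.IsLoopAt e v}.ncard := by
        rw [← hinc, ← hloop, Set.ncard_union_add_ncard_inter]; rfl
    _ = G.deg v := by
        rw [ncard_edgeSet_subtype fun _ ↦ Inc.edge_mem,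
          ncard_edgeSet_subtype fun _ ↦ IsLoopAt.edge_mem]; rfl

theorem cutDeg_eq_leaving_add_leaving [Finite E(G)] (D : G.EdgeOrientation) (S : Set α) :
    G.cutDeg S = leaving D S + leaving (reverse D) S := by
  have hdisj : Disjoint {e : E(G) | D.tail e ∈ S ∧ D.head e ∉ S}
      {e : E(G) | D.head e ∈ S ∧ D.tail e ∉ S} :=
    Set.disjoint_left.2 fun e he he' ↦ he.2 he'.1
  refine Eq.trans ?_ (Set.ncard_union_eq hdisj)
  refine (ncard_edgeSet_subtype ?_).symm.trans (congrArg Set.ncard ?_)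
  · rintro e ⟨x, -, y, -, h⟩
    exact h.edge_mem
  ext e
  constructor
  · rintro ⟨x, hx, y, hy, h⟩
    obtain ⟨rfl, rfl⟩ | ⟨rfl, rfl⟩ := h.eq_and_eq_or_eq_and_eq (D.isLink e)
    exacts [.inl ⟨hx, hy.2⟩, .inr ⟨hx, hy.2⟩]
  · rintro (⟨ht, hh⟩ | ⟨hh, ht⟩)
    · exact ⟨_, ht, _, ⟨(D.isLink e).right_mem, hh⟩, D.isLink e⟩
    · exact ⟨_, hh, _, ⟨(D.isLink e).left_mem, ht⟩, (D.isLink e).symm⟩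

theorem sum_outDeg [Finite E(G)] (D : G.EdgeOrientation) (S : Finset α) :
    ∑ v ∈ S, D.outDeg v = edgesWithin G S + leaving D S := by
  classical
  have := Fintype.ofFinite E(G)
  have hdisj : Disjoint {e : E(G) | D.tail e ∈ S ∧ D.head e ∈ S}
      {e : E(G) | D.tail e ∈ S ∧ D.head e ∉ S} :=
    Set.disjoint_left.2 fun e he he' ↦ he'.2 he.2
  have hwithin : edgesWithin G S = {e : E(G) | D.tail e ∈ S ∧ D.head e ∈ S}.ncard := by
    refine (ncard_edgeSet_subtype ?_).symm.trans (congrArg Set.ncard ?_)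
    · rintro e ⟨x, -, y, -, h⟩
      exact h.edge_mem
    ext e
    constructor
    · rintro ⟨x, hx, y, hy, h⟩
      obtain ⟨rfl, rfl⟩ | ⟨rfl, rfl⟩ := h.eq_and_eq_or_eq_and_eq (D.isLink e)
      exacts [⟨hx, hy⟩, ⟨hy, hx⟩]
    · exact fun ⟨ht, hh⟩ ↦ ⟨_, ht, _, hh, D.isLink e⟩
  calc ∑ v ∈ S, D.outDeg v
      = ∑ v ∈ S, #{e | D.tail e = v} := by
        simp only [EdgeOrientation.outDeg, Set.ncard_eq_toFinset_card', Set.toFinset_ofPred]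
    _ = #{e | D.tail e ∈ S} := sum_card_fiberwise_eq_card_filter _ _ _
    _ = {e : E(G) | D.tail e ∈ S}.ncard := by
        rw [Set.ncard_eq_toFinset_card', Set.toFinset_ofPred]
    _ = edgesWithin G S + leaving D S := by
        rw [hwithin, leaving]
        refine Eq.trans (congrArg Set.ncard ?_) (Set.ncard_union_eq hdisj)
        ext e
        by_cases h : D.head e ∈ S <;> simp [h]

theorem sum_inDeg [Finite E(G)] (D : G.EdgeOrientation) (S : Finset α) :
    ∑ v ∈ S, D.inDeg v = edgesWithin G S + leaving (reverse D) S :=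
  sum_outDeg (reverse D) S

theorem abs_sum_outDeg_sub_inDeg_le [Finite E(G)] (D : G.EdgeOrientation) (S : Finset α) :
    |∑ v ∈ S, ((D.outDeg v : ℤ) - D.inDeg v)| ≤ G.cutDeg S := by
  have hout := sum_outDeg D S
  have hin := sum_inDeg D S
  have hcut := cutDeg_eq_leaving_add_leaving D S
  rw [sum_sub_distrib, abs_le]
  zify at hout hin hcut
  constructor <;> linarith

theorem sum_deg [Finite E(G)] (S : Finset α) :
    ∑ v ∈ S, G.deg v = 2 * edgesWithin G S + G.cutDeg S := by
  obtain ⟨D⟩ := nonempty_edgeOrientation G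
  simp only [← outDeg_add_inDeg D, sum_add_distrib, sum_outDeg, sum_inDeg,
    cutDeg_eq_leaving_add_leaving D]
  ring

theorem edgesWithin_mono [Finite E(G)] {S T : Set α} (h : S ⊆ T) :
    edgesWithin G S ≤ edgesWithin G T := by
  refine Set.ncard_le_ncard ?_ ((Set.toFinite E(G)).subset ?_)
  · rintro e ⟨x, hx, y, hy, he⟩
    exact ⟨x, h hx, y, h hy, he⟩
  · rintro e ⟨x, -, y, -, he⟩
    exact he.edge_mem

theorem edgesWithin_vertexSet : edgesWithin G V(G) = E(G).ncard := by
  rw [edgesWithin, edgeSet_eq_setOfPred_exists_isLink]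
  congr 1
  ext e
  exact ⟨fun ⟨x, _, y, _, h⟩ ↦ ⟨x, y, h⟩, fun ⟨x, y, h⟩ ↦ ⟨x, h.left_mem, y, h.right_mem, h⟩⟩

theorem cutDeg_vertexSet : G.cutDeg V(G) = 0 := by
  simp [Graph.cutDeg]

theorem sum_deg_vertexSet [Fintype V(G)] [Finite E(G)] :
    ∑ v : V(G), G.deg v = 2 * E(G).ncard := by
  have h := sum_deg (G := G) V(G).toFinset
  rwa [Set.coe_toFinset, edgesWithin_vertexSet, cutDeg_vertexSet, add_zero,
    ← sum_set_coe] at h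

theorem edgeMult_comm (u v : α) : G.edgeMult u v = G.edgeMult v u := by
  simp only [Graph.edgeMult, isLink_comm]

theorem minDeg_le_deg {v : α} (hv : v ∈ V(G)) : G.minDeg ≤ G.deg v :=
  Nat.sInf_le ⟨v, hv, rfl⟩

section Loopless

variable [G.Loopless]

theorem edgeMult_self (v : α) : G.edgeMult v v = 0 := by
  simp [Graph.edgeMult]

theorem edgeMult_le_maxMult [Finite E(G)] {u v : α} (hu : u ∈ V(G)) (hv : v ∈ V(G)) :
    G.edgeMult u v ≤ G.maxMult := by
  obtain rfl | huv := eq_or_ne u v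
  · exact edgeMult_self (G := G) u ▸ zero_le
  refine le_csSup ⟨E(G).ncard, ?_⟩ ⟨u, hu, v, hv, huv, rfl⟩
  rintro _ ⟨x, -, y, -, -, rfl⟩
  exact Set.ncard_le_ncard fun e he ↦ he.edge_mem

theorem deg_eq_ncard_incidenceSet (v : α) : G.deg v = (G.incidenceSet v).ncard := by
  simp [Graph.deg, loopSet]

theorem deg_eq_sum_edgeMult [Fintype V(G)] [Finite E(G)] (v : α) :
    G.deg v = ∑ w : V(G), G.edgeMult v w := by
  have hunion : G.incidenceSet v = ⋃ w : V(G), {e | G.IsLink e v w} := by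
    ext e
    simp only [mem_incidenceSet, Set.mem_iUnion]
    exact ⟨fun ⟨w, h⟩ ↦ ⟨⟨w, h.right_mem⟩, h⟩, fun ⟨w, h⟩ ↦ ⟨w, h⟩⟩
  rw [deg_eq_ncard_incidenceSet, hunion, Set.ncard_iUnion_of_finite, finsum_eq_sum_of_fintype]
  · rfl
  · exact fun w ↦ (Set.toFinite E(G)).subset fun e he ↦ he.edge_mem
  · exact fun w w' hne ↦ Set.disjoint_left.2 fun e he he' ↦ hne (Subtype.ext (he.right_unique he'))

theorem edgesWithin_singleton (v : α) : edgesWithin G {v} = 0 := by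
  simp [edgesWithin]

theorem edgesWithin_pair (u v : α) : edgesWithin G {u, v} = G.edgeMult u v := by
  simp [edgesWithin, Graph.edgeMult, G.isLink_comm (x := v)]

theorem deg_add_deg [Finite E(G)] {u v : α} (huv : u ≠ v) :
    G.deg u + G.deg v = 2 * G.edgeMult u v + G.cutDeg {u, v} := by
  classical
  simpa [sum_pair huv, edgesWithin_pair] using sum_deg (G := G) {u, v}

theorem edgesWithin_compl_singleton_add_deg [Finite E(G)] (v : α) :
    edgesWithin G {v}ᶜ + G.deg v = E(G).ncard := by
  rw [deg_eq_ncard_incidenceSet, edgesWithin,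
    ← Set.ncard_sdiff_add_ncard_of_subset (G.incidenceSet_subset_edgeSet v)]
  congr 2
  ext e
  constructor
  · rintro ⟨x, hx, y, hy, h⟩
    exact ⟨h.edge_mem, fun hv ↦ (hv.eq_or_eq_of_isLink h).elim (Ne.symm hx) (Ne.symm hy)⟩
  · rintro ⟨he, hv⟩
    obtain ⟨x, y, h⟩ := G.exists_isLink_of_mem_edgeSet he
    exact ⟨x, fun hx ↦ hv (hx ▸ h.inc_left), y, fun hy ↦ hv (hy ▸ h.inc_right), h⟩

end Loopless

end Counting

section Realization

variable {α β : Type*} {G : Graph α β} [Finite E(G)]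

theorem card_le_edgesWithin (A : Finset E(G)) :
    #A ≤ edgesWithin G {v | ∃ e ∈ A, G.Inc e v} := by
  rw [← Set.ncard_coe_finset, ← Set.ncard_image_of_injective _ Subtype.val_injective]
  refine Set.ncard_le_ncard ?_ ((Set.toFinite E(G)).subset ?_)
  · rintro _ ⟨e, he, rfl⟩
    obtain ⟨x, y, h⟩ := G.exists_isLink_of_mem_edgeSet e.2
    exact ⟨x, ⟨e, he, h.inc_left⟩, y, ⟨e, he, h.inc_right⟩, h⟩
  · rintro e ⟨x, -, y, -, h⟩
    exact h.edge_mem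

-- Hall's theorem assigns distinct slots to the edges, each vertex `v` offering `o v` of them.
theorem exists_outDeg_eq [Fintype V(G)] (o : V(G) → ℕ) (hsum : ∑ v, o v = E(G).ncard)
    (ho : ∀ S : Finset V(G), edgesWithin G (Subtype.val '' (S : Set V(G))) ≤ ∑ v ∈ S, o v) :
    ∃ D : G.EdgeOrientation, ∀ v : V(G), D.outDeg v = o v := by
  classical
  have := Fintype.ofFinite E(G)
  have hall (A : Finset E(G)) :
      #A ≤ #{q : Σ v : V(G), Fin (o v) | ∃ e ∈ A, G.Inc e q.1} := by
    let S : Finset V(G) := {v | ∃ e ∈ A, G.Inc e v}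
    calc #A ≤ edgesWithin G {v | ∃ e ∈ A, G.Inc e v} := card_le_edgesWithin A
      _ ≤ edgesWithin G (Subtype.val '' (S : Set V(G))) :=
        edgesWithin_mono fun v ⟨e, he, hv⟩ ↦ ⟨⟨v, hv.vertex_mem⟩, by
          simpa only [S, coe_filter_univ] using ⟨e, he, hv⟩, rfl⟩
      _ ≤ ∑ v ∈ S, o v := ho S
      _ = #(S.sigma fun v ↦ (univ : Finset (Fin (o v)))) := by simp
      _ ≤ _ := card_le_card fun q hq ↦ by
        simpa only [S, mem_sigma, mem_filter_univ, mem_univ, and_true] using hq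
  obtain ⟨slot, hinj, hslot⟩ := (Fintype.all_card_le_filter_rel_iff_exists_injective
    fun (e : E(G)) (q : Σ v : V(G), Fin (o v)) ↦ G.Inc e q.1).1 hall
  have hbij : slot.Bijective := by
    refine (Fintype.bijective_iff_injective_and_card _).2 ⟨hinj, ?_⟩
    rw [Fintype.card_sigma, ← Nat.card_eq_fintype_card, Nat.card_coe_set_eq, ← hsum]
    simp only [Fintype.card_fin]
  refine ⟨⟨fun e ↦ (slot e).1, fun e ↦ (hslot e).other, fun e ↦ (hslot e).isLink_other⟩,
    fun v ↦ ?_⟩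
  calc {e : E(G) | ((slot e).1 : α) = v}.ncard
      = (slot ⁻¹' Set.range (Sigma.mk v)).ncard := by
        congr 1
        ext e
        simp [Set.range_sigmaMk, Subtype.ext_iff]
    _ = (Set.range (Sigma.mk (β := fun v ↦ Fin (o v)) v)).ncard :=
        Set.ncard_preimage_of_injective_subset_range hinj (by simp [hbij.surjective.range_eq])
    _ = o v := by
        rw [← Set.image_univ, Set.ncard_image_of_injective _ sigma_mk_injective, Set.ncard_univ,
          Nat.card_fin]

end Realization

section Residues

variable {α β : Type*} {G : Graph α β} {ℓ : ℕ} {b : V(G) → Fin (2 * ℓ)}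

theorem exists_residues [Fintype V(G)] [Finite E(G)] (hℓ : 0 < ℓ) (hb : G.IsBoundary ℓ b) :
    ∃ p : V(G) → ℕ, (∀ v, p v < ℓ) ∧ (∀ v, 2 * p v ≡ b v + G.deg v [MOD 2 * ℓ]) ∧
      ∑ v, p v ≡ E(G).ncard [MOD ℓ] := by
  obtain ⟨hparity, hsum⟩ := hb
  rw [finsum_eq_sum_of_fintype] at hsum
  have htwo (v : V(G)) : 2 * (((b v + G.deg v) / 2) % ℓ) ≡ b v + G.deg v [MOD 2 * ℓ] := by
    have heven : 2 * ((b v + G.deg v) / 2) = b v + G.deg v := by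
      have := hparity v
      simp only [Nat.ModEq] at this
      omega
    simpa only [heven] using (Nat.mod_modEq ((b v + G.deg v) / 2) ℓ).mul_left' 2
  refine ⟨fun v ↦ ((b v + G.deg v) / 2) % ℓ, fun v ↦ Nat.mod_lt _ hℓ, htwo, ?_⟩
  refine Nat.ModEq.mul_left_cancel' (c := 2) two_ne_zero ?_
  calc 2 * ∑ v, ((b v + G.deg v) / 2) % ℓ
      ≡ ∑ v : V(G), (b v + G.deg v) [MOD 2 * ℓ] := by
        rw [mul_sum]
        exact Nat.ModEq.sum fun v _ ↦ htwo v
    _ = ∑ v, (b v : ℕ) + 2 * E(G).ncard := by rw [sum_add_distrib, sum_deg_vertexSet]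
    _ ≡ 2 * E(G).ncard [MOD 2 * ℓ] := by simpa only [zero_add] using hsum.add_right _

theorem realizes_of_outDeg_modEq [Finite E(G)] {D : G.EdgeOrientation} {p : V(G) → ℕ}
    (hp : ∀ v, 2 * p v ≡ b v + G.deg v [MOD 2 * ℓ]) (hD : ∀ v : V(G), D.outDeg v ≡ p v [MOD ℓ]) :
    D.Realizes b := by
  intro v
  have h : 2 * D.outDeg v ≡ b v + (D.outDeg v + D.inDeg v) [MOD 2 * ℓ] := by
    rw [outDeg_add_inDeg]
    exact ((hD v).mul_left' 2).trans (hp v)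
  have hz := (Int.natCast_modEq_iff.2 h).sub_right (D.outDeg v + D.inDeg v : ℤ)
  push_cast at hz
  ring_nf at hz ⊢
  exact hz

theorem isBoundary_of_eq [Fintype V(G)] (hcard : Even (Fintype.card V(G)))
    (hb : ∀ v, (b v : ℕ) = ℓ) (hparity : ∀ v : V(G), G.deg v ≡ ℓ [MOD 2]) :
    G.IsBoundary ℓ b := by
  refine ⟨fun v ↦ by rw [hb v]; exact (hparity v).symm, ?_⟩
  obtain ⟨k, hk⟩ := hcard
  simp only [finsum_eq_sum_of_fintype, hb, sum_const, card_univ, hk, smul_eq_mul]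
  exact (Nat.modEq_zero_iff_dvd).2 ⟨k, by ring⟩

theorem eq_or_eq_neg_of_modEq {x : ℤ} (hx : |x| < 3 * ℓ) (h : x ≡ ℓ [ZMOD 2 * ℓ]) :
    x = ℓ ∨ x = -ℓ := by
  obtain ⟨k, hk⟩ := h.symm.dvd
  rw [abs_lt] at hx
  obtain rfl | rfl : k = 0 ∨ k = -1 := by
    have : -2 < k := by nlinarith
    have : k < 1 := by nlinarith
    omega
  · left; linarith
  · right; linarith

theorem not_realizes_of_cutDeg_lt [Fintype V(G)] [Finite E(G)] (hcard : 2 < Fintype.card V(G))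
    (hE : E(G).ncard < 3 * ℓ) (hcut : ∀ u v : V(G), u ≠ v → G.cutDeg {↑u, ↑v} < 2 * ℓ)
    (hb : ∀ v, (b v : ℕ) = ℓ) (D : G.EdgeOrientation) : ¬ D.Realizes b := by
  classical
  intro hD
  have hflow (v : V(G)) :
      (D.outDeg v - D.inDeg v : ℤ) = ℓ ∨ (D.outDeg v - D.inDeg v : ℤ) = -ℓ := by
    refine eq_or_eq_neg_of_modEq ?_ (by simpa only [hb] using hD v)
    have hout : D.outDeg v ≤ E(G).ncard := Set.ncard_le_card _
    have hin : D.inDeg v ≤ E(G).ncard := Set.ncard_le_card _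
    rw [abs_lt]
    omega
  obtain ⟨u, v, huv, hsign⟩ := Fintype.exists_ne_map_eq_of_card_lt
    (fun v : V(G) ↦ decide ((D.outDeg v - D.inDeg v : ℤ) = ℓ)) (by simpa using hcard)
  have hle := abs_sum_outDeg_sub_inDeg_le D {↑u, ↑v}
  rw [sum_pair (Subtype.coe_ne_coe.2 huv), coe_pair, abs_le] at hle
  have := hcut u v huv
  have := hflow u
  have := hflow v
  rw [decide_eq_decide] at hsign
  omega

end Residues

section FourVertices

section

variable {V : Type*} [Fintype V] {u v w x : V}

theorem toFinset_eq_univ_of_nodup [DecidableEq V] (h4 : Fintype.card V = 4)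
    (h : [u, v, w, x].Nodup) : [u, v, w, x].toFinset = univ :=
  eq_univ_of_card _ ((List.toFinset_card_of_nodup h).trans h4.symm)

theorem eq_of_nodup (h4 : Fintype.card V = 4) (h : [u, v, w, x].Nodup) (a : V) :
    a = u ∨ a = v ∨ a = w ∨ a = x := by
  classical
  simpa only [List.mem_toFinset, List.mem_cons, List.not_mem_nil, or_false] using
    (toFinset_eq_univ_of_nodup h4 h).ge (mem_univ a)

theorem sum_eq_of_nodup (h4 : Fintype.card V = 4) (h : [u, v, w, x].Nodup) (f : V → ℕ) :
    ∑ a, f a = f u + f v + f w + f x := by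
  classical
  rw [← toFinset_eq_univ_of_nodup h4 h, List.sum_toFinset f h]
  simp only [List.map_cons, List.map_nil, List.sum_cons, List.sum_nil, add_zero, add_assoc]

theorem exists_nodup_of_nodup (h4 : Fintype.card V = 4) (h : [u, v, w].Nodup) :
    ∃ x, [u, v, w, x].Nodup := by
  obtain ⟨x, hx⟩ := Cardinal.exists_notMem_of_length_lt [u, v, w]
    (by rw [Cardinal.mk_fintype, h4]; norm_num)
  exact ⟨x, by grind⟩

theorem exists_nodup_of_ne (h4 : Fintype.card V = 4) (h : u ≠ v) :
    ∃ w x, [u, v, w, x].Nodup := by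
  obtain ⟨w, hw⟩ := Cardinal.exists_notMem_of_length_lt [u, v]
    (by rw [Cardinal.mk_fintype, h4]; norm_num)
  exact ⟨w, exists_nodup_of_nodup h4 (by grind)⟩

theorem sum_add_three_eq_or (h4 : Fintype.card V = 4) {p : V → ℕ} {ℓ : ℕ} (hp : ∀ v, p v < ℓ)
    (hdvd : ℓ ∣ ∑ v, p v + 3) :
    ∑ v, p v + 3 = ℓ ∨ ∑ v, p v + 3 = 2 * ℓ ∨ ∑ v, p v + 3 = 3 * ℓ := by
  have hlt : ∑ v, (p v + 1) ≤ ∑ _v : V, ℓ := sum_le_sum fun v _ ↦ hp v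
  simp only [sum_add_distrib, sum_const, card_univ, h4, smul_eq_mul] at hlt
  obtain ⟨k, hk⟩ := hdvd
  have : k < 4 := by nlinarith
  interval_cases k <;> omega

end

variable {α β : Type*} {G : Graph α β} [Fintype V(G)] [Finite E(G)] [G.Loopless]

theorem deg_eq_of_nodup (h4 : Fintype.card V(G) = 4) {u v w x : V(G)}
    (h : [u, v, w, x].Nodup) :
    G.deg u = G.edgeMult u v + G.edgeMult u w + G.edgeMult u x ∧
    G.deg v = G.edgeMult u v + G.edgeMult v w + G.edgeMult v x ∧
    G.deg w = G.edgeMult u w + G.edgeMult v w + G.edgeMult w x ∧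
    G.deg x = G.edgeMult u x + G.edgeMult v x + G.edgeMult w x := by
  simp only [deg_eq_sum_edgeMult, sum_eq_of_nodup h4 h (fun a ↦ G.edgeMult _ a), edgeMult_self,
    edgeMult_comm (v : α) u, edgeMult_comm (w : α) u, edgeMult_comm (w : α) v,
    edgeMult_comm (x : α) u, edgeMult_comm (x : α) v, edgeMult_comm (x : α) w]
  omega

theorem ncard_edgeSet_eq_of_nodup (h4 : Fintype.card V(G) = 4) {u v w x : V(G)}
    (h : [u, v, w, x].Nodup) :
    E(G).ncard = G.edgeMult u v + G.edgeMult u w + G.edgeMult u x +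
      G.edgeMult v w + G.edgeMult v x + G.edgeMult w x := by
  have hsum := sum_deg_vertexSet (G := G)
  rw [sum_eq_of_nodup h4 h] at hsum
  have := deg_eq_of_nodup h4 h
  omega

theorem exists_outDeg_eq_of_card_eq_four (h4 : Fintype.card V(G) = 4) (o : V(G) → ℕ)
    (hsum : ∑ v, o v = E(G).ncard) (hdeg : ∀ v, o v ≤ G.deg v)
    (hmult : ∀ u v : V(G), u ≠ v → G.edgeMult u v ≤ o u + o v) :
    ∃ D : G.EdgeOrientation, ∀ v : V(G), D.outDeg v = o v := by
  classical
  refine exists_outDeg_eq o hsum fun S ↦ ?_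
  have hS : #S ≤ 4 := h4 ▸ card_le_univ S
  interval_cases hcard : #S
  · rw [card_eq_zero] at hcard
    simp [hcard, edgesWithin]
  · obtain ⟨v, rfl⟩ := card_eq_one.1 hcard
    simp [edgesWithin_singleton]
  · obtain ⟨u, v, huv, rfl⟩ := card_eq_two.1 hcard
    simpa [Set.image_pair, edgesWithin_pair, sum_pair huv] using hmult u v huv
  · obtain ⟨v, hv⟩ := card_eq_one.1 (show #Sᶜ = 1 by rw [card_compl, h4, hcard])
    have hle : edgesWithin G (Subtype.val '' (S : Set V(G))) ≤ edgesWithin G {(v : α)}ᶜ := by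
      refine edgesWithin_mono ?_
      rintro _ ⟨a, ha, rfl⟩ hav
      have : v ∈ Sᶜ := hv ▸ mem_singleton_self v
      exact mem_compl.1 this (Subtype.ext hav ▸ ha)
    have := edgesWithin_compl_singleton_add_deg (G := G) (v : α)
    have := sum_add_sum_compl S o
    rw [hv, sum_singleton] at this
    have := hdeg v
    omega
  · rw [(card_eq_iff_eq_univ S).1 (hcard.trans h4.symm), hsum]
    refine (edgesWithin_mono ?_).trans edgesWithin_vertexSet.le
    rintro _ ⟨a, -, rfl⟩
    exact a.2

end FourVertices

section Lifts

variable {α β : Type*} {G : Graph α β} {ℓ : ℕ} {p : V(G) → ℕ} {u v w x : V(G)}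

/-- The out-degrees `p` at `u` and `v` are too small to cover the edges joining `u` and `v`. -/
def IsDeficient (G : Graph α β) (p : V(G) → ℕ) (u v : V(G)) : Prop :=
  p u + p v < G.edgeMult u v

/-- The multiset `T` records how often the out-degree `p v` of each vertex `v` is raised by `ℓ`.
The raised out-degrees must not exceed the degrees, and `T` must meet every deficient pair. -/
structure IsLift (G : Graph α β) [DecidableEq V(G)] (ℓ : ℕ) (p : V(G) → ℕ)
    (T : Multiset V(G)) : Prop where
  le_deg : ∀ v, p v + ℓ * T.count v ≤ G.deg v
  mem_or_mem : ∀ u v, IsDeficient G p u v → u ∈ T ∨ v ∈ T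

theorem IsDeficient.symm (h : IsDeficient G p u v) : IsDeficient G p v u := by
  rw [IsDeficient, edgeMult_comm, add_comm]
  exact h

theorem IsDeficient.ne [G.Loopless] (h : IsDeficient G p u v) : u ≠ v := by
  rintro rfl
  simp [IsDeficient, edgeMult_self] at h

theorem isLift_replicate [DecidableEq V(G)] (hp : ∀ v, p v ≤ G.deg v) {k : ℕ} (hk : k ≠ 0)
    (hx : p x + ℓ * k ≤ G.deg x) (hdef : ∀ u v, IsDeficient G p u v → u = x ∨ v = x) :
    IsLift G ℓ p (Multiset.replicate k x) where
  le_deg v := by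
    rw [Multiset.count_replicate]
    split_ifs with h
    · exact h ▸ hx
    · simpa only [mul_zero, add_zero] using hp v
  mem_or_mem u v h :=
    (hdef u v h).imp (Multiset.mem_replicate.2 ⟨hk, ·⟩) (Multiset.mem_replicate.2 ⟨hk, ·⟩)

theorem isLift_pair [DecidableEq V(G)] (hp : ∀ v, p v ≤ G.deg v) (hwx : w ≠ x)
    (hw : p w + ℓ ≤ G.deg w) (hx : p x + ℓ ≤ G.deg x)
    (hdef : ∀ u v, IsDeficient G p u v → u = w ∨ u = x ∨ v = w ∨ v = x) :
    IsLift G ℓ p {w, x} where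
  le_deg v := by
    have := hp v
    rw [Multiset.insert_eq_cons, Multiset.count_cons, Multiset.count_singleton]
    split_ifs <;> subst_vars <;> first | contradiction | omega
  mem_or_mem u v h := by
    simpa only [Multiset.insert_eq_cons, Multiset.mem_cons, Multiset.mem_singleton, or_assoc]
      using hdef u v h

section Loopless

variable [Fintype V(G)] [G.Loopless]

theorem exists_outDeg_modEq_of_isLift [Finite E(G)] [DecidableEq V(G)] (h4 : Fintype.card V(G) = 4)
    (hμ : ∀ u v : V(G), G.edgeMult u v ≤ ℓ) {T : Multiset V(G)} (hT : IsLift G ℓ p T)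
    (hsum : ∑ v, p v + ℓ * T.card = E(G).ncard) :
    ∃ D : G.EdgeOrientation, ∀ v : V(G), D.outDeg v ≡ p v [MOD ℓ] := by
  have hcount : ∑ v, T.count v = T.card := Multiset.sum_count_eq_card fun _ _ ↦ mem_univ _
  obtain ⟨D, hD⟩ := exists_outDeg_eq_of_card_eq_four h4 (fun v ↦ p v + ℓ * T.count v)
    (by rw [sum_add_distrib, ← mul_sum, hcount, hsum]) hT.le_deg fun u v _ ↦ by
      by_cases h : IsDeficient G p u v
      · have hpos : 1 ≤ T.count u + T.count v := by
          have := (hT.mem_or_mem u v h).imp Multiset.one_le_count_iff_mem.2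
            Multiset.one_le_count_iff_mem.2
          omega
        have := hμ u v
        nlinarith
      · rw [IsDeficient] at h
        omega
  exact ⟨D, fun v ↦ by simp [hD v, Nat.ModEq]⟩

theorem add_le_deg_or_add_le_deg_of_isDeficient [Finite E(G)] (h4 : Fintype.card V(G) = 4)
    (hE : E(G).ncard + 3 = 3 * ℓ)
    (hμ : ∀ u v : V(G), G.edgeMult u v + 2 ≤ ℓ) (h : IsDeficient G p u v) :
    p u + ℓ ≤ G.deg u ∨ p v + ℓ ≤ G.deg v := by
  obtain ⟨w, x, huvwx⟩ := exists_nodup_of_ne h4 h.ne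
  have := deg_eq_of_nodup h4 huvwx
  have := ncard_edgeSet_eq_of_nodup h4 huvwx
  have := hμ w x
  rw [IsDeficient] at h
  omega

theorem not_isDeficient_of_sum_add_three_eq (h4 : Fintype.card V(G) = 4)
    (hμ : ∀ u v : V(G), G.edgeMult u v + 2 ≤ ℓ)
    (hp : ∀ v, p v < ℓ) (hsum : ∑ v, p v + 3 = 3 * ℓ) : ¬ IsDeficient G p u v := by
  intro h
  obtain ⟨w, x, huvwx⟩ := exists_nodup_of_ne h4 h.ne
  rw [sum_eq_of_nodup h4 huvwx] at hsum
  have := hμ u v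
  have := hp w
  have := hp x
  rw [IsDeficient] at h
  omega

theorem IsDeficient.inter (h4 : Fintype.card V(G) = 4) (hμ : ∀ u v : V(G), G.edgeMult u v + 2 ≤ ℓ)
    (hsum : ∑ v, p v + 3 = 2 * ℓ) (huv : IsDeficient G p u v) (hwx : IsDeficient G p w x) :
    w = u ∨ w = v ∨ x = u ∨ x = v := by
  by_contra! hne
  have hnodup : [u, v, w, x].Nodup := by
    have := huv.ne
    have := hwx.ne
    grind
  rw [sum_eq_of_nodup h4 hnodup] at hsum
  have := hμ u v
  have := hμ w x
  rw [IsDeficient] at huv hwx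
  omega

theorem sum_add_two_le_of_isDeficient [Finite E(G)] (h4 : Fintype.card V(G) = 4)
    (h : [u, v, w, x].Nodup)
    (huv : IsDeficient G p u v) (huw : IsDeficient G p u w) :
    p u + ∑ a, p a + 2 ≤ G.deg u + p x := by
  rw [sum_eq_of_nodup h4 h]
  have := deg_eq_of_nodup h4 h
  rw [IsDeficient] at huv huw
  omega

theorem not_isDeficient_of_isDeficient [Finite E(G)] (h4 : Fintype.card V(G) = 4)
    (hE : E(G).ncard + 3 = 3 * ℓ)
    (hδ : ∀ v : V(G), ℓ ≤ G.deg v + 1) (hp : ∀ v, p v < ℓ) (hsum : ∑ v, p v + 3 = 2 * ℓ)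
    (huv : IsDeficient G p u v) (hvw : IsDeficient G p v w) : ¬ IsDeficient G p u w := by
  intro huw
  have := huv.ne
  have := hvw.ne
  have := huw.ne
  obtain ⟨x, h⟩ := exists_nodup_of_nodup (u := u) (v := v) (w := w) h4 (by grind)
  rw [sum_eq_of_nodup h4 h] at hsum
  have := deg_eq_of_nodup h4 h
  have := ncard_edgeSet_eq_of_nodup h4 h
  have := hp x
  have := hδ x
  rw [IsDeficient] at huv hvw huw
  omega

theorem exists_forall_isDeficient_of_isDeficient [Finite E(G)] (h4 : Fintype.card V(G) = 4)
    (hE : E(G).ncard + 3 = 3 * ℓ)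
    (hμ : ∀ u v : V(G), G.edgeMult u v + 2 ≤ ℓ) (hδ : ∀ v : V(G), ℓ ≤ G.deg v + 1)
    (hp : ∀ v, p v < ℓ) (hsum : ∑ v, p v + 3 = 2 * ℓ)
    (huv : IsDeficient G p u v) (hu : p u + ℓ ≤ G.deg u) :
    ∃ x, p x + ℓ ≤ G.deg x ∧ ∀ a b, IsDeficient G p a b → a = x ∨ b = x := by
  by_cases hall : ∀ a b, IsDeficient G p a b → a = u ∨ b = u
  · exact ⟨u, hu, hall⟩
  obtain ⟨w, hvw, hwu⟩ : ∃ w, IsDeficient G p v w ∧ w ≠ u := by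
    push Not at hall
    obtain ⟨a, b, hab, hau, hbu⟩ := hall
    obtain rfl | rfl | rfl | rfl := huv.inter h4 hμ hsum hab
    exacts [absurd rfl hau, ⟨b, hab, hbu⟩, absurd rfl hbu, ⟨a, hab.symm, hau⟩]
  have hv : p v + ℓ ≤ G.deg v := by
    have := huv.ne
    have := hvw.ne
    obtain ⟨y, h⟩ := exists_nodup_of_nodup (u := v) (v := u) (w := w) h4 (by grind)
    have := sum_add_two_le_of_isDeficient h4 h huv.symm hvw
    have := hp y
    omega
  refine ⟨v, hv, fun a b hab ↦ ?_⟩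
  by_contra! hne
  have hmeet_uv := huv.inter h4 hμ hsum hab
  have hmeet_vw := hvw.inter h4 hμ hsum hab
  have huw := not_isDeficient_of_isDeficient h4 hE hδ hp hsum huv hvw
  obtain ⟨rfl, rfl⟩ | ⟨rfl, rfl⟩ : a = u ∧ b = w ∨ a = w ∧ b = u := by grind
  exacts [huw hab, huw hab.symm]

theorem exists_isLift_card_eq_one [Finite E(G)] [DecidableEq V(G)] (h4 : Fintype.card V(G) = 4)
    (hE : E(G).ncard + 3 = 3 * ℓ) (hμ : ∀ u v : V(G), G.edgeMult u v + 2 ≤ ℓ)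
    (hδ : ∀ v : V(G), ℓ ≤ G.deg v + 1) (hp : ∀ v, p v < ℓ) (hsum : ∑ v, p v + 3 = 2 * ℓ) :
    ∃ T : Multiset V(G), T.card = 1 ∧ IsLift G ℓ p T := by
  obtain ⟨x, hx, hdef⟩ :
      ∃ x, p x + ℓ ≤ G.deg x ∧ ∀ a b, IsDeficient G p a b → a = x ∨ b = x := by
    by_cases hnone : ∀ a b, ¬ IsDeficient G p a b
    · obtain ⟨x, hx⟩ : ∃ x, p x + ℓ ≤ G.deg x := by
        by_contra! hlt
        have : ∑ v : V(G), (G.deg v + 1) ≤ ∑ v, (p v + ℓ) := sum_le_sum fun v _ ↦ hlt v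
        simp only [sum_add_distrib, sum_deg_vertexSet, sum_const, card_univ, h4,
          smul_eq_mul] at this
        omega
      exact ⟨x, hx, fun a b h ↦ absurd h (hnone a b)⟩
    push Not at hnone
    obtain ⟨u, v, huv⟩ := hnone
    obtain hu | hv := add_le_deg_or_add_le_deg_of_isDeficient h4 hE hμ huv
    exacts [exists_forall_isDeficient_of_isDeficient h4 hE hμ hδ hp hsum huv hu,
      exists_forall_isDeficient_of_isDeficient h4 hE hμ hδ hp hsum huv.symm hv]
  exact ⟨_, Multiset.card_replicate 1 x, isLift_replicate
    (fun v ↦ by have := hp v; have := hδ v; omega) one_ne_zero (by rwa [mul_one]) hdef⟩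

theorem isLift_replicate_two [Finite E(G)] [DecidableEq V(G)] (h4 : Fintype.card V(G) = 4)
    (hE : E(G).ncard + 3 = 3 * ℓ)
    (hμ : ∀ u v : V(G), G.edgeMult u v + 2 ≤ ℓ) (hp : ∀ v, p v ≤ G.deg v)
    (hsum : ∑ v, p v + 3 = ℓ) (h : [u, v, w, x].Nodup) (hu : G.deg u < p u + ℓ)
    (hv : G.deg v < p v + ℓ) (hw : G.deg w < p w + ℓ) :
    IsLift G ℓ p (Multiset.replicate 2 x) := by
  refine isLift_replicate hp two_ne_zero ?_ fun a b hab ↦ ?_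
  · have hdeg := sum_deg_vertexSet (G := G)
    rw [sum_eq_of_nodup h4 h] at hdeg hsum
    omega
  · have hlt (c : V(G)) (hc : c ≠ x) : G.deg c < p c + ℓ := by
      obtain rfl | rfl | rfl | rfl := eq_of_nodup h4 h c
      exacts [hu, hv, hw, absurd rfl hc]
    by_contra! hne
    have := hlt a hne.1
    have := hlt b hne.2
    have := add_le_deg_or_add_le_deg_of_isDeficient h4 hE hμ hab
    omega

theorem isLift_pair_of_not_isDeficient [DecidableEq V(G)] (h4 : Fintype.card V(G) = 4)
    (hp : ∀ v, p v ≤ G.deg v)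
    (h : [u, v, w, x].Nodup) (huv : ¬ IsDeficient G p u v) (hw : p w + ℓ ≤ G.deg w)
    (hx : p x + ℓ ≤ G.deg x) : IsLift G ℓ p {w, x} := by
  refine isLift_pair hp (by grind) hw hx fun a b hab ↦ ?_
  have := hab.ne
  have := eq_of_nodup h4 h a
  have := eq_of_nodup h4 h b
  have := hab.symm
  grind

theorem exists_not_isDeficient_of_deg_lt [Finite E(G)] (h4 : Fintype.card V(G) = 4)
    (hsum : ∑ v, p v + 3 = ℓ)
    (hu : G.deg u < p u + ℓ) : ∃ v ≠ u, ¬ IsDeficient G p u v := by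
  by_contra! hdef
  have : Nontrivial V(G) := Fintype.one_lt_card_iff_nontrivial.1 (by omega)
  obtain ⟨v, hv⟩ := exists_ne u
  obtain ⟨w, x, h⟩ := exists_nodup_of_ne h4 hv.symm
  rw [sum_eq_of_nodup h4 h] at hsum
  have := deg_eq_of_nodup h4 h
  have huv := hdef v hv
  have huw := hdef w (by grind)
  have hux := hdef x (by grind)
  rw [IsDeficient] at huv huw hux
  omega

theorem exists_not_isDeficient_of_forall_le_deg [Finite E(G)] (h4 : Fintype.card V(G) = 4)
    (hE : E(G).ncard + 3 = 3 * ℓ) (hμ : ∀ u v : V(G), G.edgeMult u v + 2 ≤ ℓ)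
    (hsum : ∑ v, p v + 3 = ℓ) (huv : u ≠ v) (hdef : ¬ IsDeficient G p u v)
    (htriple : ∀ a b c : V(G), [a, b, c].Nodup → G.deg a < p a + ℓ → G.deg b < p b + ℓ →
      p c + ℓ ≤ G.deg c) :
    ∃ a b : V(G), a ≠ b ∧ ¬ IsDeficient G p a b ∧ ∀ c, c ≠ a → c ≠ b → p c + ℓ ≤ G.deg c := by
  by_cases hpair : ∃ a b : V(G), a ≠ b ∧ G.deg a < p a + ℓ ∧ G.deg b < p b + ℓ
  · obtain ⟨a, b, hab, ha, hb⟩ := hpair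
    refine ⟨a, b, hab, fun h ↦ ?_, fun c hca hcb ↦ htriple a b c (by grind) ha hb⟩
    have := add_le_deg_or_add_le_deg_of_isDeficient h4 hE hμ h
    omega
  push Not at hpair
  by_cases hone : ∃ a : V(G), G.deg a < p a + ℓ
  · obtain ⟨a, ha⟩ := hone
    obtain ⟨b, hba, hab⟩ := exists_not_isDeficient_of_deg_lt h4 hsum ha
    exact ⟨a, b, hba.symm, hab, fun c hca _ ↦ hpair a c hca.symm ha⟩
  · push Not at hone
    exact ⟨u, v, huv, hdef, fun c _ _ ↦ hone c⟩

theorem exists_isLift_card_eq_two [Finite E(G)] [DecidableEq V(G)] (h4 : Fintype.card V(G) = 4)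
    (hE : E(G).ncard + 3 = 3 * ℓ) (hμ : ∀ u v : V(G), G.edgeMult u v + 2 ≤ ℓ)
    (hp : ∀ v, p v ≤ G.deg v) (hsum : ∑ v, p v + 3 = ℓ) (huv : u ≠ v)
    (hdef : ¬ IsDeficient G p u v) : ∃ T : Multiset V(G), T.card = 2 ∧ IsLift G ℓ p T := by
  by_cases htriple : ∃ a b c : V(G), [a, b, c].Nodup ∧ G.deg a < p a + ℓ ∧ G.deg b < p b + ℓ ∧
      G.deg c < p c + ℓ
  · obtain ⟨a, b, c, habc, ha, hb, hc⟩ := htriple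
    obtain ⟨x, h⟩ := exists_nodup_of_nodup h4 habc
    exact ⟨_, Multiset.card_replicate 2 x, isLift_replicate_two h4 hE hμ hp hsum h ha hb hc⟩
  push Not at htriple
  obtain ⟨a, b, hab, hab_def, hle⟩ :=
    exists_not_isDeficient_of_forall_le_deg h4 hE hμ hsum huv hdef htriple
  obtain ⟨w, x, h⟩ := exists_nodup_of_ne h4 hab
  exact ⟨{w, x}, Multiset.card_pair w x, isLift_pair_of_not_isDeficient h4 hp h hab_def
    (hle w (by grind) (by grind)) (hle x (by grind) (by grind))⟩

theorem edgeMult_eq_of_forall_isDeficient [Finite E(G)] (h4 : Fintype.card V(G) = 4)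
    (hE : E(G).ncard + 3 = 3 * ℓ)
    (hsum : ∑ v, p v + 3 = ℓ) (hdef : ∀ u v, u ≠ v → IsDeficient G p u v) (huv : u ≠ v) :
    G.edgeMult u v = p u + p v + 1 := by
  obtain ⟨w, x, h⟩ := exists_nodup_of_ne h4 huv
  have := ncard_edgeSet_eq_of_nodup h4 h
  rw [sum_eq_of_nodup h4 h] at hsum
  have hlt (a b : V(G)) (hab : a ≠ b) : p a + p b < G.edgeMult a b := hdef a b hab
  have := hlt u v (by grind)
  have := hlt u w (by grind)
  have := hlt u x (by grind)
  have := hlt v w (by grind)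
  have := hlt v x (by grind)
  have := hlt w x (by grind)
  omega

theorem deg_eq_of_forall_isDeficient [Finite E(G)] (h4 : Fintype.card V(G) = 4)
    (hE : E(G).ncard + 3 = 3 * ℓ) (hsum : ∑ v, p v + 3 = ℓ)
    (hdef : ∀ u v, u ≠ v → IsDeficient G p u v) (v : V(G)) : G.deg v = 2 * p v + ℓ := by
  have : Nontrivial V(G) := Fintype.one_lt_card_iff_nontrivial.1 (by omega)
  obtain ⟨u, huv⟩ := exists_ne v
  obtain ⟨w, x, h⟩ := exists_nodup_of_ne h4 huv.symm
  have hmult {a b : V(G)} (hab : a ≠ b) := edgeMult_eq_of_forall_isDeficient h4 hE hsum hdef hab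
  rw [(deg_eq_of_nodup h4 h).1, hmult huv.symm, hmult (by grind : v ≠ w),
    hmult (by grind : v ≠ x), ← hsum, sum_eq_of_nodup h4 h]
  ring

theorem cutDeg_add_two_eq_of_forall_isDeficient [Finite E(G)] (h4 : Fintype.card V(G) = 4)
    (hE : E(G).ncard + 3 = 3 * ℓ) (hsum : ∑ v, p v + 3 = ℓ)
    (hdef : ∀ u v, u ≠ v → IsDeficient G p u v) (huv : u ≠ v) :
    G.cutDeg {↑u, ↑v} + 2 = 2 * ℓ := by
  have := deg_add_deg (G := G) (Subtype.coe_ne_coe.2 huv)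
  have := edgeMult_eq_of_forall_isDeficient h4 hE hsum hdef huv
  have := deg_eq_of_forall_isDeficient h4 hE hsum hdef u
  have := deg_eq_of_forall_isDeficient h4 hE hsum hdef v
  omega

theorem exists_outDeg_modEq_or_forall_isDeficient [Finite E(G)] (h4 : Fintype.card V(G) = 4)
    (hE : E(G).ncard + 3 = 3 * ℓ) (hμ : ∀ u v : V(G), G.edgeMult u v + 2 ≤ ℓ)
    (hδ : ∀ v : V(G), ℓ ≤ G.deg v + 1) (hp : ∀ v, p v < ℓ)
    (hmod : ∑ v, p v ≡ E(G).ncard [MOD ℓ]) :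
    (∃ D : G.EdgeOrientation, ∀ v : V(G), D.outDeg v ≡ p v [MOD ℓ]) ∨
      ∑ v, p v + 3 = ℓ ∧ ∀ u v, u ≠ v → IsDeficient G p u v := by
  classical
  have hdeg (v : V(G)) : p v ≤ G.deg v := by
    have := hp v
    have := hδ v
    omega
  have hreal {T : Multiset V(G)} (hT : IsLift G ℓ p T)
      (h : ∑ v, p v + ℓ * T.card = E(G).ncard) :=
    exists_outDeg_modEq_of_isLift h4 (fun u v ↦ (Nat.le_add_right _ 2).trans (hμ u v)) hT h
  have hdvd : ℓ ∣ ∑ v, p v + 3 := by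
    have h := hmod.add_right 3
    rw [hE] at h
    exact (h.dvd_iff dvd_rfl).2 (Dvd.intro_left 3 rfl)
  obtain hsum | hsum | hsum := sum_add_three_eq_or h4 hp hdvd
  · refine or_iff_not_imp_right.2 fun hnot ↦ ?_
    push Not at hnot
    obtain ⟨u, v, huv, hdef⟩ := hnot hsum
    obtain ⟨T, hcard, hT⟩ := exists_isLift_card_eq_two h4 hE hμ hdeg hsum huv hdef
    exact hreal hT (by rw [hcard]; omega)
  · obtain ⟨T, hcard, hT⟩ := exists_isLift_card_eq_one h4 hE hμ hδ hp hsum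
    exact .inl (hreal hT (by rw [hcard]; omega))
  · have hT : IsLift G ℓ p 0 :=
      ⟨by simpa only [Multiset.count_zero, mul_zero, add_zero] using hdeg,
        fun u v h ↦ absurd h (not_isDeficient_of_sum_add_three_eq h4 hμ hp hsum)⟩
    exact .inl (hreal hT (by rw [Multiset.card_zero]; omega))

theorem eq_of_forall_isDeficient [Finite E(G)] {b : V(G) → Fin (2 * ℓ)}
    (h4 : Fintype.card V(G) = 4) (hE : E(G).ncard + 3 = 3 * ℓ)
    (hpb : ∀ v, 2 * p v ≡ b v + G.deg v [MOD 2 * ℓ]) (hsum : ∑ v, p v + 3 = ℓ)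
    (hdef : ∀ u v, u ≠ v → IsDeficient G p u v) (v : V(G)) : (b v : ℕ) = ℓ := by
  have hzero : b v + ℓ ≡ 0 [MOD 2 * ℓ] := by
    refine Nat.ModEq.add_right_cancel' (2 * p v) ?_
    have h := hpb v
    rw [deg_eq_of_forall_isDeficient h4 hE hsum hdef] at h
    simpa only [zero_add, add_assoc, add_comm ℓ] using h.symm
  have hle : 2 * ℓ ≤ b v + ℓ := Nat.le_of_dvd (by omega) (Nat.modEq_zero_iff_dvd.1 hzero)
  have hsub : b v + ℓ - 2 * ℓ = 0 := Nat.eq_zero_of_dvd_of_lt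
    (Nat.dvd_sub (Nat.modEq_zero_iff_dvd.1 hzero) dvd_rfl) (by have := (b v).isLt; omega)
  omega

theorem isBoundary_and_not_realizes_iff [Finite E(G)] (h4 : Fintype.card V(G) = 4)
    (hE : E(G).ncard + 3 = 3 * ℓ) (hμ : ∀ u v : V(G), G.edgeMult u v + 2 ≤ ℓ)
    (hδ : ∀ v : V(G), ℓ ≤ G.deg v + 1) (b : V(G) → Fin (2 * ℓ)) :
    (G.IsBoundary ℓ b ∧ ¬ ∃ D : G.EdgeOrientation, D.Realizes b) ↔
      ((∀ S : Set α, S ⊆ V(G) → S.ncard = 2 → G.cutDeg S = 2 * ℓ - 2) ∧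
        ∀ v ∈ V(G), G.deg v ≡ ℓ [MOD 2]) ∧ ∀ v, (b v : ℕ) = ℓ := by
  constructor
  · rintro ⟨hb, hnot⟩
    obtain ⟨p, hp, hpb, hmod⟩ := exists_residues (by omega) hb
    obtain ⟨D, hD⟩ | ⟨hsum, hdef⟩ :=
      exists_outDeg_modEq_or_forall_isDeficient h4 hE hμ hδ hp hmod
    · exact absurd ⟨D, realizes_of_outDeg_modEq hpb hD⟩ hnot
    refine ⟨⟨fun S hS hS2 ↦ ?_, fun v hv ↦ ?_⟩, eq_of_forall_isDeficient h4 hE hpb hsum hdef⟩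
    · obtain ⟨u, v, huv, rfl⟩ := Set.ncard_eq_two.1 hS2
      rw [Set.pair_subset_iff] at hS
      exact Nat.eq_sub_of_add_eq (cutDeg_add_two_eq_of_forall_isDeficient (u := ⟨u, hS.1⟩)
        (v := ⟨v, hS.2⟩) h4 hE hsum hdef (Subtype.coe_ne_coe.1 huv))
    · simp [deg_eq_of_forall_isDeficient h4 hE hsum hdef ⟨v, hv⟩, Nat.ModEq]
  · rintro ⟨⟨hcut, hparity⟩, hb⟩
    refine ⟨isBoundary_of_eq (h4 ▸ by decide) hb fun v ↦ hparity v v.2, not_exists.2 <|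
      not_realizes_of_cutDeg_lt (by omega) (by omega) (fun u v huv ↦ ?_) hb⟩
    rw [hcut _ (Set.pair_subset u.2 v.2) (Set.ncard_pair (Subtype.coe_ne_coe.2 huv))]
    omega

end Loopless

end Lifts

end ModularOrientation

theorem mainTheorem1 {α β : Type*} (G : Graph α β) (hloopless : G.Loopless)
    (ℓ : ℕ) (hℓ : 3 ≤ ℓ)
    (hV : V(G).ncard = 4) (hE : E(G).ncard = 3 * ℓ - 3)
    (hμ : G.maxMult ≤ ℓ - 2) (hδ : ℓ - 1 ≤ G.minDeg) :
    (¬ G.StronglyConnectedMod ℓ ↔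
      (∀ S : Set α, S ⊆ V(G) → S.ncard = 2 → G.cutDeg S = 2 * ℓ - 2) ∧
        (∀ v ∈ V(G), G.deg v ≡ ℓ [MOD 2])) ∧
    (¬ G.StronglyConnectedMod ℓ →
      ∀ b : V(G) → Fin (2 * ℓ),
        (G.IsBoundary ℓ b ∧ ¬ ∃ D : G.EdgeOrientation, D.Realizes b) ↔
          ∀ v : V(G), (b v : ℕ) = ℓ) := by
  have hV0 : V(G).ncard ≠ 0 := by omega
  have hE0 : E(G).ncard ≠ 0 := by omega
  have := (Set.finite_of_ncard_ne_zero hV0).fintype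
  have := (Set.finite_of_ncard_ne_zero hE0).to_subtype
  have h4 : Fintype.card V(G) = 4 := by rw [← Nat.card_eq_fintype_card, Nat.card_coe_set_eq, hV]
  have hmult (u v : V(G)) : G.edgeMult u v + 2 ≤ ℓ := by
    have := ModularOrientation.edgeMult_le_maxMult u.2 v.2
    omega
  have hdeg (v : V(G)) : ℓ ≤ G.deg v + 1 := by
    have := ModularOrientation.minDeg_le_deg v.2
    omega
  have hbad : ¬ G.StronglyConnectedMod ℓ ↔
      ∃ b, G.IsBoundary ℓ b ∧ ¬ ∃ D : G.EdgeOrientation, D.Realizes b := by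
    simp only [Graph.StronglyConnectedMod, not_forall, exists_prop]
  simp only [hbad, ModularOrientation.isBoundary_and_not_realizes_iff h4 (by omega) hmult hdeg]
  refine ⟨⟨fun ⟨_, h, _⟩ ↦ h, fun h ↦ ⟨fun _ ↦ ⟨ℓ, by omega⟩, h, fun _ ↦ rfl⟩⟩, ?_⟩
  rintro ⟨-, h, -⟩ b
  exact and_iff_right h
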